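/- Let $H$ be a finite simple graph with maximum degree $\Delta$, and let $G=L^2(H)$ be the square of the line graph of $H$: its vertices are the edges of $H$, and two of them are adjacent in $G$ if and only if they are at distance $1$ or $2$ in the line graph $L(H)$. For $S\subseteq E(H)$ and $e\in E(H)$ write $N_G(e)$ for the neighbourhood of $e$ in $G$ (the strong neighbourhood of $e$) and $d_S(e)=|S\cap N_G(e)|$. Let $\eta\in[0,0.3]$, and let $F\subseteq E(H)$ be the (unique) inclusion-maximal set of edges such that $d_F(e)\ge (2-\eta)\Delta^2$ for every $e\in F$. For $e\in E(H)$ put $F_e=F\cap N_G(e)$. Then for every $e\in F$, the subgraph $G[F_e]$ of $G$ induced by $F_e$ satisfies $$|E(G[F_e])|\le\left(\frac{31}{6}-\frac{128}{3(10-3\eta)}+4\eta-\eta^2\right)\Delta^4 .$$ -/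

import Mathlib

/-- The square of a graph: distinct vertices are adjacent iff they are at distance `1` or `2`.
(`SimpleGraph.dist` is `0` for equal vertices and for vertices in different components.) -/
def graphSquare {V : Type*} (G : SimpleGraph V) : SimpleGraph V where
  Adj u v := G.dist u v = 1 ∨ G.dist u v = 2
  symm := ⟨fun u v h => by rwa [G.dist_comm] at h⟩
  loopless := ⟨fun u h => by simp at h⟩

/-- The square `L²(H)` of the line graph of `H`; its vertices are the edges of `H`. -/
def squareLineGraph {V : Type*} (H : SimpleGraph V) : SimpleGraph H.edgeSet :=
  graphSquare H.lineGraph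

/-- The strong neighbourhood of an edge `e` of `H`: its neighbourhood in `L²(H)`. -/
def strongNeighborhood {V : Type*} (H : SimpleGraph V) (e : H.edgeSet) : Set H.edgeSet :=
  (squareLineGraph H).neighborSet e

/-- The `F`-degree of an edge `e` of `H`: the number of edges in `F` that lie in the strong
neighbourhood of `e`. -/
noncomputable def strongDegreeIn {V : Type*} (H : SimpleGraph V) (F : Set H.edgeSet)
    (e : H.edgeSet) : ℕ :=
  (F ∩ strongNeighborhood H e).ncard

/-- Every edge in `F` has `F`-degree at least `d`. -/
def HasMinStrongDegree {V : Type*} (H : SimpleGraph V) (d : ℝ) (F : Set H.edgeSet) : Prop :=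
  ∀ e ∈ F, d ≤ (strongDegreeIn H F e : ℝ)

open Finset

/-! Write `e = uv` and X = N(u) ∪ N(v). Then |X| ≤ 2Δ and every edge of F_e meets X. Edges adjacent
in L²(H) have at least one crossing, i.e. an adjacency between an end of one and an end of the
other. So |E(G[F_e])| is at most the number of crossings minus the excess, which counts crossings
beyond the first for each pair of edges. The crossings amount to a sum of D(a)D(c) over adjacent a,
c, where D is the degree in F_e. `sum_mul_mul_le` bounds it through the first three moments of α(y),
the number of F_e-neighbours in X of a vertex y outside X. The second moment is the gain to control.
If it is large, there are many 4-cycles of F_e between X and its complement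
(`sq_sum_sq_le_sum_four_cycles`), and each creates excess. But an edge of F has at most 2Δ²
crossings with F and at least (2-η)Δ² strong neighbours there, hence excess at most ηΔ²
(`sum_excess_le`). What remains is a two-variable optimisation. -/

/-! ### Numerical optimisation. -/

theorem final_bound {η b A P : ℝ} (h0 : 0 ≤ η) (h1 : η ≤ 3 / 10) (hb1 : b ≤ 1) (hb : 1 - η ≤ b)
    (hA : A ^ 2 ≤ η * (1 + b)) (hP : P ≤ 1 - b + 3 * A - A ^ 2 / b - A ^ 2 / 2) :
    P ≤ 31 / 6 - 128 / (3 * (10 - 3 * η)) + 4 * η - η ^ 2 := by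
  have hbp : 0 < b := by linarith
  -- Tangent lines replace the nonlinear terms: AM-GM with equality at A = 11/20, then the tangent
  -- to 1/b at 17/20, the midpoint of [0.7, 1].
  have e1 : 3 * A ≤ A ^ 2 * (30 / 11) + 33 / 40 := by nlinarith [sq_nonneg (A - 11 / 20)]
  have e2 : 40 / 17 - 400 / 289 * b ≤ 1 / b := by
    rw [le_div_iff₀ hbp]; nlinarith [sq_nonneg (b - 17 / 20)]
  have e3 : A ^ 2 * (40 / 17 - 400 / 289 * b) ≤ A ^ 2 / b := by
    rw [div_eq_mul_one_div (A ^ 2) b]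
    exact mul_le_mul_of_nonneg_left e2 (sq_nonneg A)
  have e4 : 0 ≤ 30 / 11 - (40 / 17 - 400 / 289 * b) - 1 / 2 := by linarith
  have e5 := mul_le_mul_of_nonneg_right hA e4
  have e6 : 128 / (3 * (10 - 3 * η)) ≤ 64 / 15 + 32 / 25 * η + 24 / 50 * η ^ 2 := by
    rw [div_le_iff₀ (by linarith)]
    nlinarith [mul_nonneg h0 (sq_nonneg η), mul_nonneg h0 h0]
  have e7 : 1 - b + 33 / 40 + η * (1 + b) * (30 / 11 - (40 / 17 - 400 / 289 * b) - 1 / 2) ≤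
      31 / 6 - (64 / 15 + 32 / 25 * η + 24 / 50 * η ^ 2) + 4 * η - η ^ 2 := by
    have k1 : 0 ≤ η * ((b - (1 - η)) * (1 - b)) :=
      mul_nonneg h0 (mul_nonneg (by linarith) (by linarith))
    have k2 : 0 ≤ 3 / 40 - 797 / 1000 * η + 254 / 100 * η ^ 2 - 1385 / 1000 * η ^ 3 := by
      nlinarith [mul_nonneg (sub_nonneg.2 h1) (sq_nonneg (η - 37 / 200)), sq_nonneg (η - 37 / 200)]
    have k3 : 0 ≤ 3 / 40 + 2 / 10 * η - 148 / 100 * η ^ 2 := by nlinarith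
    -- Expanded in 1 - b, which lies in [0, η]; the sign of its coefficient decides which end of
    -- that interval is the worst case.
    have k4 : 1 - b + 33 / 40 + η * (1 + b) * (30 / 11 - (40 / 17 - 400 / 289 * b) - 1 / 2) =
        33 / 40 + 8001 / 3179 * η + (1 - b) * (1 - 25601 / 6358 * η + 400 / 289 * η ^ 2)
          - 400 / 289 * (η * ((b - (1 - η)) * (1 - b))) := by ring
    rw [k4]
    rcases le_total 0 (1 - 25601 / 6358 * η + 400 / 289 * η ^ 2) with hs | hs
    · have k5 := mul_le_mul_of_nonneg_right (show 1 - b ≤ η by linarith) hs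
      nlinarith [mul_nonneg h0 h0, mul_nonneg h0 (mul_nonneg h0 h0)]
    · have k5 := mul_nonpos_of_nonneg_of_nonpos (show 0 ≤ 1 - b by linarith) hs
      nlinarith [mul_nonneg h0 h0]
  nlinarith

/-- B, S, T are the moments of α, E is a quarter of the ordered excess, M is |F_e|. Setting B = 2bΔ²
and S = 2AΔ³ removes Δ; Cauchy–Schwarz gives T ≥ 2(A²/b)Δ⁴. -/
theorem scaled_bound {Δ η B S T E M P : ℝ} (hΔ : 0 < Δ) (h0 : 0 ≤ η) (h1 : η ≤ 3 / 10)
    (hT : S ^ 2 ≤ B * T) (hE : S ^ 2 ≤ 4 * Δ ^ 2 * E) (hEM : E ≤ η * Δ ^ 2 * M)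
    (hM : M ≤ Δ ^ 2 + B / 2) (hM' : (2 - η) * Δ ^ 2 ≤ M) (hB : B ≤ 2 * Δ ^ 2)
    (hP : 2 * P ≤ Δ ^ 2 * (2 * Δ ^ 2 - B) + 3 * Δ * S - T - E) :
    P ≤ (31 / 6 - 128 / (3 * (10 - 3 * η)) + 4 * η - η ^ 2) * Δ ^ 4 := by
  have hΔ2 : 0 < Δ ^ 2 := by positivity
  have hΔ4 : 0 < Δ ^ 4 := by positivity
  obtain ⟨b, rfl⟩ : ∃ b, B = 2 * b * Δ ^ 2 := ⟨B / (2 * Δ ^ 2), by field_simp⟩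
  obtain ⟨A, rfl⟩ : ∃ A, S = 2 * A * Δ ^ 3 := ⟨S / (2 * Δ ^ 3), by field_simp⟩
  have hb1 : b ≤ 1 := le_of_mul_le_mul_right (by linarith) hΔ2
  have hb : 1 - η ≤ b := le_of_mul_le_mul_right (by linarith) hΔ2
  have hbp : 0 < b := by linarith
  have hE' : A ^ 2 * Δ ^ 4 ≤ E := by
    refine le_of_mul_le_mul_left (le_trans (le_of_eq ?_) hE) (show 0 < 4 * Δ ^ 2 by positivity)
    ring
  have hT' : 2 * (A ^ 2 / b) * Δ ^ 4 ≤ T := by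
    refine le_of_mul_le_mul_left (le_trans (le_of_eq ?_) hT)
      (show 0 < 2 * b * Δ ^ 2 by positivity)
    field_simp
  have hA : A ^ 2 ≤ η * (1 + b) := by
    refine le_of_mul_le_mul_right (hE'.trans (hEM.trans ?_)) hΔ4
    have := mul_le_mul_of_nonneg_left hM (show 0 ≤ η * Δ ^ 2 by positivity)
    linarith
  rw [← div_le_iff₀ hΔ4]
  refine final_bound h0 h1 hb1 hb hA ?_
  rw [div_le_iff₀ hΔ4]
  linarith

/-! ### Crossings and excess for 0/1 weights on ordered pairs. -/

theorem sum_mul_crossing {V : Type*} [Fintype V] {h r : V → V → ℝ}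
    (rs : ∀ a b, r a b = r b a) :
    ∑ a, ∑ b, ∑ c, ∑ d, r a b * r c d * (h a c + h a d + h b c + h b d) =
      4 * ∑ a, ∑ c, (∑ b, r a b) * (∑ d, r c d) * h a c := by
  have key : ∑ a, ∑ b, ∑ c, ∑ d, r a b * r c d * h a c =
      ∑ a, ∑ c, (∑ b, r a b) * (∑ d, r c d) * h a c := by
    refine sum_congr rfl fun a _ => ?_
    rw [sum_comm]
    refine sum_congr rfl fun c _ => ?_
    rw [sum_mul_sum, sum_mul]
    exact sum_congr rfl fun b _ => by rw [sum_mul]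
  have k2 : ∑ a, ∑ b, ∑ c, ∑ d, r a b * r c d * h a d =
      ∑ a, ∑ b, ∑ c, ∑ d, r a b * r c d * h a c := by
    refine sum_congr rfl fun a _ => sum_congr rfl fun b _ => ?_
    rw [sum_comm]
    exact sum_congr rfl fun c _ => sum_congr rfl fun d _ => by rw [rs d c]
  have k3 : ∑ a, ∑ b, ∑ c, ∑ d, r a b * r c d * h b c =
      ∑ a, ∑ b, ∑ c, ∑ d, r a b * r c d * h a c := by
    rw [sum_comm]
    exact sum_congr rfl fun a _ => sum_congr rfl fun b _ => sum_congr rfl fun c _ =>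
      sum_congr rfl fun d _ => by rw [rs b a]
  have k4 : ∑ a, ∑ b, ∑ c, ∑ d, r a b * r c d * h b d =
      ∑ a, ∑ b, ∑ c, ∑ d, r a b * r c d * h a d := by
    rw [sum_comm]
    exact sum_congr rfl fun a _ => sum_congr rfl fun b _ => sum_congr rfl fun c _ =>
      sum_congr rfl fun d _ => by rw [rs b a]
  simp only [mul_add, sum_add_distrib]
  rw [k4, k2, k3, key]
  ring

/-- A nonnegative `g` invariant under swapping each pair has four disjoint equal `X`–`Xᶜ` blocks. -/
theorem four_mul_sum_le_of_swap_invariant {V : Type*} [Fintype V] [DecidableEq V] (X : Finset V)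
    (g : V → V → V → V → ℝ) (g0 : ∀ a b c d, 0 ≤ g a b c d)
    (g1 : ∀ a b c d, g a b c d = g b a c d) (g2 : ∀ a b c d, g a b c d = g a b d c) :
    4 * ∑ a ∈ X, ∑ b ∈ Xᶜ, ∑ c ∈ X, ∑ d ∈ Xᶜ, g a b c d ≤
      ∑ a, ∑ b, ∑ c, ∑ d, g a b c d := by
  have step : ∀ f : V → V → ℝ, (∀ a b, 0 ≤ f a b) → (∀ a b, f a b = f b a) →
      2 * ∑ a ∈ X, ∑ b ∈ Xᶜ, f a b ≤ ∑ a, ∑ b, f a b := by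
    intro f f0 f1
    have e : ∑ a, ∑ b, f a b = (∑ a ∈ X, ∑ b ∈ X, f a b + ∑ a ∈ X, ∑ b ∈ Xᶜ, f a b) +
        (∑ a ∈ Xᶜ, ∑ b ∈ X, f a b + ∑ a ∈ Xᶜ, ∑ b ∈ Xᶜ, f a b) := by
      rw [← sum_add_distrib, ← sum_add_distrib]
      simp only [sum_add_sum_compl]
    have e1 : ∑ a ∈ Xᶜ, ∑ b ∈ X, f a b = ∑ a ∈ X, ∑ b ∈ Xᶜ, f a b := by
      rw [sum_comm]
      exact sum_congr rfl fun a _ => sum_congr rfl fun b _ => f1 _ _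
    have p1 : 0 ≤ ∑ a ∈ X, ∑ b ∈ X, f a b := sum_nonneg fun _ _ => sum_nonneg fun _ _ => f0 _ _
    have p2 : 0 ≤ ∑ a ∈ Xᶜ, ∑ b ∈ Xᶜ, f a b := sum_nonneg fun _ _ => sum_nonneg fun _ _ => f0 _ _
    rw [e, e1]; linarith
  have s1 := step (fun a b => ∑ c, ∑ d, g a b c d)
    (fun a b => sum_nonneg fun _ _ => sum_nonneg fun _ _ => g0 _ _ _ _)
    (fun a b => sum_congr rfl fun c _ => sum_congr rfl fun d _ => g1 _ _ _ _)
  have s2 : ∑ a ∈ X, ∑ b ∈ Xᶜ, (2 * ∑ c ∈ X, ∑ d ∈ Xᶜ, g a b c d) ≤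
      ∑ a ∈ X, ∑ b ∈ Xᶜ, ∑ c, ∑ d, g a b c d :=
    sum_le_sum fun a _ => sum_le_sum fun b _ =>
      step (fun c d => g a b c d) (fun _ _ => g0 _ _ _ _) (fun _ _ => g2 _ _ _ _)
  simp only [← mul_sum] at s2
  linarith

/-- Cauchy–Schwarz over pairs in X: the second moment is the sum of their codegrees into Y, and the
squared codegrees count 4-cycles, degenerate ones included. -/
theorem sq_sum_sq_le_sum_four_cycles {V : Type*} (r : V → V → ℝ) (X Y : Finset V) :
    (∑ y ∈ Y, (∑ x ∈ X, r x y) ^ 2) ^ 2 ≤ (#X : ℝ) ^ 2 *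
      ∑ a ∈ X, ∑ b ∈ Y, ∑ c ∈ X, ∑ d ∈ Y, r a b * r c d * (r a d * r c b) := by
  have e : ∑ a ∈ X, ∑ b ∈ Y, ∑ c ∈ X, ∑ d ∈ Y, r a b * r c d * (r a d * r c b) =
      ∑ p ∈ X ×ˢ X, (∑ y ∈ Y, r p.1 y * r p.2 y) ^ 2 := by
    rw [sum_product]
    refine sum_congr rfl fun a _ => ?_
    rw [sum_comm]
    refine sum_congr rfl fun c _ => ?_
    rw [sq, sum_mul_sum]
    exact sum_congr rfl fun b _ => sum_congr rfl fun d _ => by ring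
  have e2 : ∑ y ∈ Y, (∑ x ∈ X, r x y) ^ 2 = ∑ p ∈ X ×ˢ X, ∑ y ∈ Y, r p.1 y * r p.2 y := by
    rw [sum_comm]
    refine sum_congr rfl fun y _ => ?_
    rw [sq, sum_mul_sum, sum_product]
  rw [e, e2]
  refine sq_sum_le_card_mul_sum_sq.trans (le_of_eq ?_)
  rw [card_product]; push_cast; ring

/-- Split the pairs by membership in X. Outside X the degree D equals α, since `r` vanishes off X;
inside X only D ≤ Δ is used. -/
theorem sum_mul_mul_le {V : Type*} [Fintype V] [DecidableEq V] {h r : V → V → ℝ} {X : Finset V}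
    {Δ : ℝ} (hs : ∀ a b, h a b = h b a) (rs : ∀ a b, r a b = r b a) (r0 : ∀ a b, 0 ≤ r a b)
    (rh : ∀ a b, r a b ≤ h a b) (hΔ : ∀ a, ∑ b, h a b ≤ Δ)
    (hX : ∀ a b, a ∉ X → b ∉ X → r a b = 0) (hc : (#X : ℝ) ≤ 2 * Δ) :
    ∑ a, ∑ c, (∑ b, r a b) * (∑ d, r c d) * h a c ≤
      Δ ^ 2 * (2 * Δ ^ 2 - ∑ y ∈ Xᶜ, ∑ x ∈ X, r x y) +
        3 * Δ * ∑ y ∈ Xᶜ, (∑ x ∈ X, r x y) ^ 2 - ∑ y ∈ Xᶜ, (∑ x ∈ X, r x y) ^ 3 := by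
  have h0 : ∀ a b, 0 ≤ h a b := fun a b => (r0 a b).trans (rh a b)
  set D : V → ℝ := fun a => ∑ b, r a b with hD
  set α : V → ℝ := fun y => ∑ x ∈ X, r x y with hα
  set β : V → ℝ := fun y => ∑ x ∈ X, h x y with hβ
  have D0 : ∀ a, 0 ≤ D a := fun a => sum_nonneg fun _ _ => r0 _ _
  have DΔ : ∀ a, D a ≤ Δ := fun a => (sum_le_sum fun _ _ => rh _ _).trans (hΔ a)
  have Dα : ∀ y ∈ Xᶜ, D y = α y := by
    intro y hy
    rw [mem_compl] at hy
    simp only [hD, hα]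
    rw [← sum_add_sum_compl X, sum_eq_zero (s := Xᶜ), add_zero]
    · exact sum_congr rfl fun x _ => rs _ _
    · intro z hz
      exact hX _ _ hy (mem_compl.1 hz)
  have α0 : ∀ y, 0 ≤ α y := fun a => sum_nonneg fun _ _ => r0 _ _
  have αβ : ∀ y, α y ≤ β y := fun a => sum_le_sum fun _ _ => rh _ _
  have αΔ : ∀ y ∈ Xᶜ, α y ≤ Δ := fun y hy => Dα y hy ▸ DΔ y
  have βΔ : ∀ y, β y + ∑ z ∈ Xᶜ, h y z ≤ Δ := by
    intro y
    refine le_trans (le_of_eq ?_) (hΔ y)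
    rw [← sum_add_sum_compl X]
    congr 1
    exact sum_congr rfl fun x _ => hs _ _
  have split : ∑ a, ∑ c, D a * D c * h a c =
      ∑ a ∈ X, ∑ c ∈ X, D a * D c * h a c + 2 * ∑ y ∈ Xᶜ, ∑ x ∈ X, D x * D y * h x y
        + ∑ a ∈ Xᶜ, ∑ c ∈ Xᶜ, D a * D c * h a c := by
    have e : ∑ a, ∑ b, D a * D b * h a b =
        (∑ a ∈ X, ∑ b ∈ X, D a * D b * h a b + ∑ a ∈ X, ∑ b ∈ Xᶜ, D a * D b * h a b) +
        (∑ a ∈ Xᶜ, ∑ b ∈ X, D a * D b * h a b + ∑ a ∈ Xᶜ, ∑ b ∈ Xᶜ, D a * D b * h a b) := by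
      rw [← sum_add_distrib, ← sum_add_distrib]
      simp only [sum_add_sum_compl]
    have e1 : ∑ a ∈ X, ∑ b ∈ Xᶜ, D a * D b * h a b = ∑ y ∈ Xᶜ, ∑ x ∈ X, D x * D y * h x y :=
      sum_comm
    have e2 : ∑ a ∈ Xᶜ, ∑ b ∈ X, D a * D b * h a b = ∑ y ∈ Xᶜ, ∑ x ∈ X, D x * D y * h x y :=
      sum_congr rfl fun a _ => sum_congr rfl fun b _ => by rw [hs a b]; ring
    rw [e, e1, e2]; ring
  have t1 : ∑ a ∈ X, ∑ c ∈ X, D a * D c * h a c ≤ Δ ^ 2 * ∑ a ∈ X, ∑ c ∈ X, h a c := by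
    simp only [mul_sum]
    refine sum_le_sum fun a _ => sum_le_sum fun c _ => mul_le_mul_of_nonneg_right ?_ (h0 _ _)
    rw [sq]
    exact mul_le_mul (DΔ a) (DΔ c) (D0 c) ((D0 a).trans (DΔ a))
  have t2 : ∑ y ∈ Xᶜ, ∑ x ∈ X, D x * D y * h x y ≤ ∑ y ∈ Xᶜ, Δ * α y * β y := by
    refine sum_le_sum fun y hy => ?_
    simp only [hβ, mul_sum]
    refine sum_le_sum fun x _ => mul_le_mul_of_nonneg_right ?_ (h0 _ _)
    rw [← Dα y hy]
    exact mul_le_mul_of_nonneg_right (DΔ x) (D0 y)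
  have t3 : ∑ a ∈ Xᶜ, ∑ c ∈ Xᶜ, D a * D c * h a c ≤ ∑ y ∈ Xᶜ, α y ^ 2 * (Δ - β y) := by
    have a1 : ∑ a ∈ Xᶜ, ∑ c ∈ Xᶜ, D a * D c * h a c ≤
        ∑ a ∈ Xᶜ, ∑ c ∈ Xᶜ, (D a ^ 2 * h a c / 2 + D c ^ 2 * h a c / 2) := by
      refine sum_le_sum fun a _ => sum_le_sum fun c _ => ?_
      nlinarith [mul_nonneg (h0 a c) (sq_nonneg (D a - D c))]
    have a2 : ∑ a ∈ Xᶜ, ∑ c ∈ Xᶜ, D c ^ 2 * h a c / 2 =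
        ∑ a ∈ Xᶜ, ∑ c ∈ Xᶜ, D a ^ 2 * h a c / 2 := by
      rw [sum_comm]
      exact sum_congr rfl fun a _ => sum_congr rfl fun c _ => by rw [hs]
    have a3 : ∑ a ∈ Xᶜ, ∑ c ∈ Xᶜ, D a ^ 2 * h a c / 2 =
        (∑ y ∈ Xᶜ, D y ^ 2 * ∑ z ∈ Xᶜ, h y z) / 2 := by
      simp only [mul_sum, sum_div]
    have a4 : ∑ y ∈ Xᶜ, D y ^ 2 * ∑ z ∈ Xᶜ, h y z ≤ ∑ y ∈ Xᶜ, α y ^ 2 * (Δ - β y) := by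
      refine sum_le_sum fun y hy => ?_
      rw [Dα y hy]
      exact mul_le_mul_of_nonneg_left (by linarith [βΔ y]) (sq_nonneg _)
    simp only [sum_add_distrib] at a1
    rw [a2, a3] at a1
    linarith
  have t4 : ∑ y ∈ Xᶜ, (2 * (Δ * α y * β y) + α y ^ 2 * (Δ - β y)) ≤
      ∑ y ∈ Xᶜ, (Δ ^ 2 * (β y - α y) + 3 * Δ * α y ^ 2 - α y ^ 3) := by
    refine sum_le_sum fun y _ => ?_
    -- The difference of the two sides is exactly (β - α)(Δ - α)².
    nlinarith [mul_nonneg (sub_nonneg.2 (αβ y)) (sq_nonneg (Δ - α y))]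
  have t5 : ∑ a ∈ X, ∑ c ∈ X, h a c + ∑ y ∈ Xᶜ, β y ≤ 2 * Δ ^ 2 := by
    have : ∑ y ∈ Xᶜ, β y = ∑ a ∈ X, ∑ c ∈ Xᶜ, h a c := sum_comm
    rw [this, ← sum_add_distrib]
    simp only [sum_add_sum_compl]
    by_cases hXe : X.Nonempty
    · obtain ⟨x, _⟩ := hXe
      have Δ0 : 0 ≤ Δ := (D0 x).trans (DΔ x)
      have := sum_le_sum fun a (_ : a ∈ X) => hΔ a
      rw [sum_const, nsmul_eq_mul] at this
      nlinarith
    · rw [not_nonempty_iff_eq_empty.1 hXe, sum_empty]; positivity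
  have t6 := mul_le_mul_of_nonneg_left t5 (sq_nonneg Δ)
  simp only [sum_add_distrib, sum_sub_distrib, ← mul_sum] at t4 t2
  change ∑ a, ∑ c, D a * D c * h a c ≤ Δ ^ 2 * (2 * Δ ^ 2 - ∑ y ∈ Xᶜ, α y) +
    3 * Δ * ∑ y ∈ Xᶜ, α y ^ 2 - ∑ y ∈ Xᶜ, α y ^ 3
  rw [split]
  linarith

theorem sum_mul_min_crossing_le {V : Type*} [Fintype V] [DecidableEq V] {h r : V → V → ℝ}
    {X : Finset V} {Δ η : ℝ} (hΔ0 : 0 < Δ) (h0 : 0 ≤ η) (h1 : η ≤ 3 / 10)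
    (hs : ∀ a b, h a b = h b a) (rs : ∀ a b, r a b = r b a) (r01 : ∀ a b, r a b = 0 ∨ r a b = 1)
    (hnn : ∀ a b, 0 ≤ h a b) (rh : ∀ a b, r a b ≤ h a b) (hΔ : ∀ a, ∑ b, h a b ≤ Δ)
    (hX : ∀ a b, a ∉ X → b ∉ X → r a b = 0) (hc : (#X : ℝ) ≤ 2 * Δ)
    (hexc : ∀ a b, r a b = 1 → ∑ c, ∑ d, r c d * (h a c + h a d + h b c + h b d -
      min 1 (h a c + h a d + h b c + h b d)) ≤ 2 * η * Δ ^ 2)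
    (hr : 2 * ((2 - η) * Δ ^ 2) ≤ ∑ a, ∑ b, r a b) :
    ∑ a, ∑ b, ∑ c, ∑ d, r a b * r c d * min 1 (h a c + h a d + h b c + h b d) ≤
      8 * ((31 / 6 - 128 / (3 * (10 - 3 * η)) + 4 * η - η ^ 2) * Δ ^ 4) := by
  have r0 : ∀ a b, 0 ≤ r a b := fun a b => by rcases r01 a b with e | e <;> norm_num [e]
  have hQ := sum_mul_mul_le hs rs r0 rh hΔ hX hc
  rw [← mul_le_mul_iff_right₀ (show (0 : ℝ) < 4 by norm_num), ← sum_mul_crossing rs] at hQ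
  set g : V → V → V → V → ℝ := fun a b c d => r a b * r c d *
    (h a c + h a d + h b c + h b d - min 1 (h a c + h a d + h b c + h b d)) with hg
  have g0 : ∀ a b c d, 0 ≤ g a b c d := fun a b c d =>
    mul_nonneg (mul_nonneg (r0 _ _) (r0 _ _)) (sub_nonneg.2 (min_le_right _ _))
  have hgs : ∑ a, ∑ b, ∑ c, ∑ d, r a b * r c d * min 1 (h a c + h a d + h b c + h b d) =
      ∑ a, ∑ b, ∑ c, ∑ d, r a b * r c d * (h a c + h a d + h b c + h b d) -
        ∑ a, ∑ b, ∑ c, ∑ d, g a b c d := by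
    simp only [← sum_sub_distrib]
    refine sum_congr rfl fun a _ => sum_congr rfl fun b _ => sum_congr rfl fun c _ =>
      sum_congr rfl fun d _ => ?_
    simp only [hg]; ring
  have hg4 := four_mul_sum_le_of_swap_invariant X g g0
    (fun a b c d => by
      simp only [hg, rs b a]
      rw [show h b c + h b d + h a c + h a d = h a c + h a d + h b c + h b d by ring])
    (fun a b c d => by
      simp only [hg, rs d c]
      rw [show h a d + h a c + h b d + h b c = h a c + h a d + h b c + h b d by ring])
  -- In a 4-cycle the pairs ad and cb are two crossings of ab with cd, so the excess is at least 1.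
  have hC : ∑ a ∈ X, ∑ b ∈ Xᶜ, ∑ c ∈ X, ∑ d ∈ Xᶜ, r a b * r c d * (r a d * r c b) ≤
      ∑ a ∈ X, ∑ b ∈ Xᶜ, ∑ c ∈ X, ∑ d ∈ Xᶜ, g a b c d := by
    refine sum_le_sum fun a _ => sum_le_sum fun b _ => sum_le_sum fun c _ =>
      sum_le_sum fun d _ => mul_le_mul_of_nonneg_left ?_ (mul_nonneg (r0 _ _) (r0 _ _))
    have m0 := sub_nonneg.2 (min_le_right 1 (h a c + h a d + h b c + h b d))
    rcases r01 a d with e1 | e1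
    · rw [e1, zero_mul]; exact m0
    rcases r01 c b with e2 | e2
    · rw [e2, mul_zero]; exact m0
    have := rh a d; have := rh c b; have := hnn a c; have := hnn b d
    have := min_le_left 1 (h a c + h a d + h b c + h b d)
    rw [e1, e2] at *
    rw [hs b c]
    rw [hs b c] at this
    linarith
  have hS := sq_sum_sq_le_sum_four_cycles r X Xᶜ
  have hE : ∑ a, ∑ b, ∑ c, ∑ d, g a b c d ≤ (∑ a, ∑ b, r a b) * (2 * η * Δ ^ 2) := by
    simp only [sum_mul]
    refine sum_le_sum fun a _ => sum_le_sum fun b _ => ?_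
    simp only [hg, mul_assoc (r a b), ← mul_sum]
    rcases r01 a b with e | e
    · rw [e, zero_mul, zero_mul]
    · rw [e, one_mul, one_mul]; exact hexc a b e
  set B := ∑ y ∈ Xᶜ, ∑ x ∈ X, r x y with hB
  set S := ∑ y ∈ Xᶜ, (∑ x ∈ X, r x y) ^ 2 with hSd
  set T := ∑ y ∈ Xᶜ, (∑ x ∈ X, r x y) ^ 3 with hTd
  set C := ∑ a ∈ X, ∑ b ∈ Xᶜ, ∑ c ∈ X, ∑ d ∈ Xᶜ, r a b * r c d * (r a d * r c b) with hCd
  set E := ∑ a, ∑ b, ∑ c, ∑ d, g a b c d with hEd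
  set R := ∑ a, ∑ b, r a b with hRd
  have α0 : ∀ y, 0 ≤ ∑ x ∈ X, r x y := fun y => sum_nonneg fun _ _ => r0 _ _
  have hT : S ^ 2 ≤ B * T :=
    sum_sq_le_sum_mul_sum_of_sq_le_mul _ (fun y _ => α0 y) (fun y _ => pow_nonneg (α0 y) 3)
      (fun y _ => le_of_eq (by ring))
  have hXX : ∑ a ∈ X, ∑ b ∈ X, r a b + B ≤ 2 * Δ ^ 2 := by
    have : B = ∑ a ∈ X, ∑ c ∈ Xᶜ, r a c := sum_comm
    rw [this, ← sum_add_distrib]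
    simp only [sum_add_sum_compl]
    have : ∑ a ∈ X, ∑ b, r a b ≤ ∑ a ∈ X, Δ :=
      sum_le_sum fun a _ => (sum_le_sum fun b _ => rh a b).trans (hΔ a)
    rw [sum_const, nsmul_eq_mul] at this
    nlinarith
  have hXX0 : 0 ≤ ∑ a ∈ X, ∑ b ∈ X, r a b := sum_nonneg fun _ _ => sum_nonneg fun _ _ => r0 _ _
  have hR : R = ∑ a ∈ X, ∑ b ∈ X, r a b + 2 * B := by
    have e : R = (∑ a ∈ X, ∑ b ∈ X, r a b + ∑ a ∈ X, ∑ b ∈ Xᶜ, r a b) +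
        (∑ a ∈ Xᶜ, ∑ b ∈ X, r a b + ∑ a ∈ Xᶜ, ∑ b ∈ Xᶜ, r a b) := by
      rw [← sum_add_distrib, ← sum_add_distrib]
      simp only [sum_add_sum_compl, hRd]
    have e1 : ∑ a ∈ Xᶜ, ∑ b ∈ X, r a b = B :=
      sum_congr rfl fun a _ => sum_congr rfl fun b _ => rs _ _
    have e2 : ∑ a ∈ X, ∑ b ∈ Xᶜ, r a b = B := sum_comm
    have e3 : ∑ a ∈ Xᶜ, ∑ b ∈ Xᶜ, r a b = 0 :=
      sum_eq_zero fun a ha => sum_eq_zero fun b hb => hX a b (mem_compl.1 ha) (mem_compl.1 hb)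
    rw [e, e1, e2, e3]; ring
  have hC0 : 0 ≤ C := sum_nonneg fun _ _ => sum_nonneg fun _ _ => sum_nonneg fun _ _ =>
    sum_nonneg fun _ _ => by
      simp only [mul_nonneg, r0]
  have hSE : S ^ 2 ≤ 4 * Δ ^ 2 * (E / 4) := by
    have k : (#X : ℝ) ^ 2 ≤ 4 * Δ ^ 2 := by
      have := pow_le_pow_left₀ (Nat.cast_nonneg _) hc 2
      linarith
    have := mul_le_mul_of_nonneg_right k hC0
    have := mul_le_mul_of_nonneg_left (show C ≤ E / 4 by linarith)
      (show 0 ≤ 4 * Δ ^ 2 by positivity)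
    linarith
  have := scaled_bound (M := R / 2) (P := (∑ a, ∑ b, ∑ c, ∑ d, r a b * r c d *
      min 1 (h a c + h a d + h b c + h b d)) / 8) hΔ0 h0 h1 hT hSE (by linarith) (by linarith)
    (by linarith) (by linarith) (by linarith)
  linarith

/-! ### From L²(H) to sums over vertices. -/

/-- A shared end is adjacent to the other end of its own edge, so it too yields a crossing;
otherwise the middle edge of a path of length 2 is one. -/
theorem squareLineGraph_adj_crossing {V : Type*} {H : SimpleGraph V} {f g : H.edgeSet}
    (hfg : (squareLineGraph H).Adj f g) {a b c d : V} (hf : (f : Sym2 V) = s(a, b))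
    (hg : (g : Sym2 V) = s(c, d)) : H.Adj a c ∨ H.Adj a d ∨ H.Adj b c ∨ H.Adj b d := by
  have hab : H.Adj a b := by have := f.2; rwa [hf, SimpleGraph.mem_edgeSet] at this
  have share : ∀ x : V, x ∈ (f : Sym2 V) → x ∈ (g : Sym2 V) →
      H.Adj a c ∨ H.Adj a d ∨ H.Adj b c ∨ H.Adj b d := by
    intro x hxf hxg
    rw [hf, Sym2.mem_iff] at hxf
    rw [hg, Sym2.mem_iff] at hxg
    have := hab.symm
    rcases hxf with rfl | rfl <;> rcases hxg with rfl | rfl <;> tauto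
  change H.lineGraph.dist f g = 1 ∨ H.lineGraph.dist f g = 2 at hfg
  rcases hfg with h1 | h2
  · rw [SimpleGraph.dist_eq_one_iff_adj, SimpleGraph.lineGraph_adj_iff_exists] at h1
    obtain ⟨_, x, hx, hx'⟩ := h1
    exact share x hx hx'
  · obtain ⟨w, hw⟩ := SimpleGraph.exists_walk_of_dist_ne_zero (by rw [h2]; norm_num)
    rw [h2] at hw
    obtain ⟨k, hk1, hk2⟩ : ∃ k, H.lineGraph.Adj f k ∧ H.lineGraph.Adj k g := by
      cases w with
      | nil => simp at hw
      | cons h p =>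
        cases p with
        | nil => simp at hw
        | cons h' q =>
          cases q with
          | nil => exact ⟨_, h, h'⟩
          | cons h'' q => simp at hw
    rw [SimpleGraph.lineGraph_adj_iff_exists] at hk1 hk2
    obtain ⟨_, x, hx, hx'⟩ := hk1
    obtain ⟨_, y, hy, hy'⟩ := hk2
    by_cases hxy : x = y
    · exact share x hx (hxy ▸ hy')
    · have hk := (Sym2.mem_and_mem_iff hxy).1 ⟨hx', hy⟩
      have hadj : H.Adj x y := by have := k.2; rwa [hk, SimpleGraph.mem_edgeSet] at this
      rw [hf, Sym2.mem_iff] at hx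
      rw [hg, Sym2.mem_iff] at hy'
      rcases hx with rfl | rfl <;> rcases hy' with rfl | rfl <;> tauto

/-- Summing over ordered pairs of adjacent vertices counts every edge twice. -/
theorem sum_sum_edge {V : Type*} [Fintype V] (H : SimpleGraph V) [Fintype H.edgeSet]
    (φ : Sym2 V → ℝ) (hφ : ∀ z, z ∉ H.edgeSet → φ z = 0) :
    ∑ a, ∑ b, φ s(a, b) = 2 * ∑ f : H.edgeSet, φ f := by
  classical
  have e : ∑ f : H.edgeSet, φ f = ∑ z ∈ H.edgeFinset, φ z :=
    (Finset.sum_subtype H.edgeFinset (fun _ => SimpleGraph.mem_edgeFinset) φ).symm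
  rw [e, ← Fintype.sum_prod_type' (fun a b => φ s(a, b)),
    ← Finset.sum_fiberwise (s := univ) (g := fun p : V × V => s(p.1, p.2)), mul_sum]
  rw [← Finset.sum_subset (Finset.subset_univ H.edgeFinset)]
  · refine sum_congr rfl fun z hz => ?_
    induction z with
    | _ a b =>
      rw [SimpleGraph.mem_edgeFinset, SimpleGraph.mem_edgeSet] at hz
      have : (univ.filter fun p : V × V => s(p.1, p.2) = s(a, b)) = {(a, b), (b, a)} := by
        ext ⟨x, y⟩
        simp
      rw [this, sum_pair (by simp [hz.ne]), Sym2.eq_swap (a := b)]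
      ring
  · intro z _ hz
    refine sum_eq_zero fun p hp => ?_
    rw [mem_filter] at hp
    rw [hp.2]
    exact hφ z (by rwa [SimpleGraph.mem_edgeFinset] at hz)

theorem two_mul_ncard_edgeSet_induce {W : Type*} [Fintype W] (G : SimpleGraph W) (T : Set W)
    [DecidablePred (· ∈ T)] [DecidableRel G.Adj] :
    2 * ((G.induce T).edgeSet.ncard : ℝ) =
      ∑ f, ∑ g, if f ∈ T ∧ g ∈ T ∧ G.Adj f g then (1 : ℝ) else 0 := by
  classical
  have e := (G.induce T).sum_degrees_eq_twice_card_edges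
  rw [Set.ncard_eq_toFinset_card']
  have e' : ((∑ v, (G.induce T).degree v : ℕ) : ℝ) = 2 * (#(G.induce T).edgeFinset : ℝ) := by
    rw [e]; push_cast; rfl
  rw [show (G.induce T).edgeSet.toFinset = (G.induce T).edgeFinset from rfl, ← e']
  push_cast
  have sub : ∀ φ : W → ℝ, ∑ f : T, φ f = ∑ f, if f ∈ T then φ f else 0 := by
    intro φ
    rw [← Finset.sum_filter]
    exact (Finset.sum_subtype _ (by simp) φ).symm
  have deg : ∀ f : T, ((G.induce T).degree f : ℝ) =
      ∑ g, if g ∈ T then (if G.Adj f g then (1 : ℝ) else 0) else 0 := by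
    intro f
    rw [← sub (fun g => if G.Adj f g then (1 : ℝ) else 0), ← SimpleGraph.card_neighborFinset_eq_degree,
      SimpleGraph.neighborFinset_eq_filter, Finset.sum_boole]
    rfl
  rw [sum_congr rfl fun f _ => deg f,
    sub fun f => ∑ g, if g ∈ T then (if G.Adj f g then (1 : ℝ) else 0) else 0]
  refine sum_congr rfl fun f _ => ?_
  by_cases hf : f ∈ T
  · simp only [hf, true_and, if_true, ite_and]
  · simp [hf]

open Classical in
/-- The indicator of a set of edges of `H`, extended by zero to all unordered pairs. -/
noncomputable def edgeIndicator {V : Type*} {H : SimpleGraph V} (T : Set H.edgeSet)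
    (z : Sym2 V) : ℝ :=
  if ∃ hz : z ∈ H.edgeSet, (⟨z, hz⟩ : H.edgeSet) ∈ T then 1 else 0

section edgeIndicator

variable {V : Type*} {H : SimpleGraph V}

theorem edgeIndicator_eq_zero_or_one (T : Set H.edgeSet) (z : Sym2 V) :
    edgeIndicator T z = 0 ∨ edgeIndicator T z = 1 := by
  unfold edgeIndicator
  split_ifs <;> simp

theorem edgeIndicator_nonneg (T : Set H.edgeSet) (z : Sym2 V) : 0 ≤ edgeIndicator T z := by
  rcases edgeIndicator_eq_zero_or_one T z with e | e <;> simp [e]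

theorem edgeIndicator_eq_one_iff {T : Set H.edgeSet} {z : Sym2 V} :
    edgeIndicator T z = 1 ↔ ∃ hz : z ∈ H.edgeSet, (⟨z, hz⟩ : H.edgeSet) ∈ T := by
  unfold edgeIndicator
  split_ifs with h <;> simp [h]

theorem edgeIndicator_of_notMem_edgeSet (T : Set H.edgeSet) {z : Sym2 V} (hz : z ∉ H.edgeSet) :
    edgeIndicator T z = 0 :=
  if_neg fun ⟨h, _⟩ => hz h

theorem edgeIndicator_mono {S T : Set H.edgeSet} (hST : S ⊆ T) (z : Sym2 V) :
    edgeIndicator S z ≤ edgeIndicator T z := by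
  rcases edgeIndicator_eq_zero_or_one S z with e | e
  · rw [e]; exact edgeIndicator_nonneg T z
  · obtain ⟨hz, h⟩ := edgeIndicator_eq_one_iff.1 e
    rw [e, edgeIndicator_eq_one_iff.2 ⟨hz, hST h⟩]

theorem edgeIndicator_le_adj [DecidableRel H.Adj] (T : Set H.edgeSet) (a b : V) :
    edgeIndicator T s(a, b) ≤ if H.Adj a b then 1 else 0 := by
  split_ifs with h
  · rcases edgeIndicator_eq_zero_or_one T s(a, b) with e | e <;> simp [e]
  · exact (edgeIndicator_of_notMem_edgeSet T h).le

theorem sum_edgeIndicator [Fintype V] (T : Set H.edgeSet) :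
    ∑ a, ∑ b, edgeIndicator T s(a, b) = 2 * (T.ncard : ℝ) := by
  classical
  have : Fintype H.edgeSet := Fintype.ofFinite _
  rw [sum_sum_edge H _ fun z hz => edgeIndicator_of_notMem_edgeSet T hz]
  congr 1
  have : ∀ f : H.edgeSet, edgeIndicator T f = if f ∈ T then 1 else 0 := by
    intro f
    unfold edgeIndicator
    simp
  rw [sum_congr rfl fun f _ => this f, Finset.sum_boole, Set.ncard_eq_toFinset_card']
  congr 2
  ext f
  simp

end edgeIndicator

section crossing

variable {V : Type*} {H : SimpleGraph V} [DecidableRel H.Adj]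

theorem min_crossing_eq_one {f g : H.edgeSet} (hfg : (squareLineGraph H).Adj f g) {a b c d : V}
    (hf : (f : Sym2 V) = s(a, b)) (hg : (g : Sym2 V) = s(c, d)) :
    min (1 : ℝ) ((if H.Adj a c then 1 else 0) + (if H.Adj a d then 1 else 0) +
      (if H.Adj b c then 1 else 0) + (if H.Adj b d then 1 else 0)) = 1 := by
  rw [min_eq_left]
  have n : ∀ x y, (0 : ℝ) ≤ if H.Adj x y then 1 else 0 := fun x y => by split_ifs <;> norm_num
  have := n a c; have := n a d; have := n b c; have := n b d
  rcases squareLineGraph_adj_crossing hfg hf hg with h | h | h | h <;> rw [if_pos h] at * <;>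
    linarith

theorem sum_adj_le [Fintype V] {Δ : ℕ} (hΔ : H.maxDegree = Δ) (a : V) :
    ∑ b, (if H.Adj a b then (1 : ℝ) else 0) ≤ Δ := by
  rw [Finset.sum_boole, ← SimpleGraph.neighborFinset_eq_filter,
    SimpleGraph.card_neighborFinset_eq_degree, ← hΔ]
  exact_mod_cast H.degree_le_maxDegree a

/-- In ordered pairs, each of the four crossing terms sums to at most Δ², while the truncated sum is
at least twice the `F`-degree. -/
theorem sum_excess_le [Fintype V] {Δ : ℕ} (hΔ : H.maxDegree = Δ) {η : ℝ} {F : Set H.edgeSet}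
    (hF : HasMinStrongDegree H ((2 - η) * (Δ : ℝ) ^ 2) F) {f : H.edgeSet} (hf : f ∈ F) {a b : V}
    (hab : (f : Sym2 V) = s(a, b)) :
    ∑ c, ∑ d, edgeIndicator F s(c, d) * ((if H.Adj a c then 1 else 0) +
        (if H.Adj a d then 1 else 0) + (if H.Adj b c then 1 else 0) +
        (if H.Adj b d then 1 else 0) - min 1 ((if H.Adj a c then 1 else 0) +
        (if H.Adj a d then 1 else 0) + (if H.Adj b c then 1 else 0) +
        (if H.Adj b d then 1 else 0))) ≤ 2 * η * (Δ : ℝ) ^ 2 := by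
  set h : V → V → ℝ := fun x y => if H.Adj x y then 1 else 0 with hh
  set r : V → V → ℝ := fun x y => edgeIndicator F s(x, y) with hr
  have h0 : ∀ x y, 0 ≤ h x y := fun x y => by simp only [hh]; split_ifs <;> norm_num
  have r0 : ∀ x y, 0 ≤ r x y := fun x y => edgeIndicator_nonneg F _
  have upper : ∀ x, ∑ c, ∑ d, r c d * h x c ≤ (Δ : ℝ) ^ 2 := by
    intro x
    calc ∑ c, ∑ d, r c d * h x c = ∑ c, (∑ d, r c d) * h x c := by simp only [sum_mul]
      _ ≤ ∑ c, (Δ : ℝ) * h x c := sum_le_sum fun c _ => mul_le_mul_of_nonneg_right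
          ((sum_le_sum fun d _ => edgeIndicator_le_adj F c d).trans (sum_adj_le hΔ c)) (h0 _ _)
      _ = Δ * ∑ c, h x c := by rw [mul_sum]
      _ ≤ Δ * Δ := mul_le_mul_of_nonneg_left (sum_adj_le hΔ x) (Nat.cast_nonneg _)
      _ = (Δ : ℝ) ^ 2 := (sq _).symm
  have swap : ∀ x, ∑ c, ∑ d, r c d * h x d = ∑ c, ∑ d, r c d * h x c := by
    intro x
    rw [sum_comm]
    exact sum_congr rfl fun c _ => sum_congr rfl fun d _ => by simp only [hr, Sym2.eq_swap]
  have lower : 2 * ((2 - η) * (Δ : ℝ) ^ 2) ≤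
      ∑ c, ∑ d, r c d * min 1 (h a c + h a d + h b c + h b d) := by
    refine (mul_le_mul_of_nonneg_left (hF f hf) zero_le_two).trans ?_
    unfold strongDegreeIn
    rw [← sum_edgeIndicator]
    refine sum_le_sum fun c _ => sum_le_sum fun d _ => ?_
    have m0 : 0 ≤ min 1 (h a c + h a d + h b c + h b d) :=
      le_min zero_le_one (by linarith [h0 a c, h0 a d, h0 b c, h0 b d])
    rcases edgeIndicator_eq_zero_or_one (F ∩ strongNeighborhood H f) s(c, d) with e | e
    · rw [e]; exact mul_nonneg (r0 _ _) m0
    · obtain ⟨hz, hm⟩ := edgeIndicator_eq_one_iff.1 e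
      have e1 : r c d = 1 := edgeIndicator_eq_one_iff.2 ⟨hz, hm.1⟩
      have e2 : min 1 (h a c + h a d + h b c + h b d) = 1 :=
        min_crossing_eq_one (g := ⟨_, hz⟩) hm.2 hab rfl
      rw [e, e1, e2, mul_one]
  change ∑ c, ∑ d, r c d * (h a c + h a d + h b c + h b d -
    min 1 (h a c + h a d + h b c + h b d)) ≤ _
  simp only [mul_sub, mul_add, sum_sub_distrib, sum_add_distrib, swap]
  linarith [upper a, upper b]

end crossing

/-- The factor 8 is the order of the two edges times the two orientations of each. -/
theorem eight_mul_ncard_edgeSet_induce_le {V : Type*} [Fintype V] (H : SimpleGraph V) [DecidableRel H.Adj]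
    (T : Set H.edgeSet) :
    8 * (((squareLineGraph H).induce T).edgeSet.ncard : ℝ) ≤
      ∑ a, ∑ b, ∑ c, ∑ d, edgeIndicator T s(a, b) * edgeIndicator T s(c, d) *
        min 1 ((if H.Adj a c then 1 else 0) + (if H.Adj a d then 1 else 0) +
          (if H.Adj b c then 1 else 0) + (if H.Adj b d then 1 else 0)) := by
  classical
  have e := two_mul_ncard_edgeSet_induce (squareLineGraph H) T
  set K : Sym2 V → Sym2 V → ℝ := fun z w =>
    if ∃ (hz : z ∈ H.edgeSet) (hw : w ∈ H.edgeSet), (⟨z, hz⟩ : H.edgeSet) ∈ T ∧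
      (⟨w, hw⟩ : H.edgeSet) ∈ T ∧ (squareLineGraph H).Adj ⟨z, hz⟩ ⟨w, hw⟩ then 1 else 0 with hK
  have e2 : ∑ a, ∑ b, ∑ c, ∑ d, K s(a, b) s(c, d) =
      4 * ∑ f : H.edgeSet, ∑ g : H.edgeSet, K f g := by
    rw [sum_sum_edge H (fun z => ∑ c, ∑ d, K z s(c, d))]
    · have inner : ∀ f : H.edgeSet, ∑ c, ∑ d, K f s(c, d) = 2 * ∑ g : H.edgeSet, K f g :=
        fun f => sum_sum_edge H (fun w => K f w) fun w hw => if_neg fun ⟨_, h, _⟩ => hw h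
      simp only [inner, ← mul_sum]
      ring
    · exact fun z hz => sum_eq_zero fun c _ => sum_eq_zero fun d _ => if_neg fun ⟨h, _⟩ => hz h
  have e3 : ∑ f : H.edgeSet, ∑ g : H.edgeSet, K f g =
      ∑ f, ∑ g, if f ∈ T ∧ g ∈ T ∧ (squareLineGraph H).Adj f g then (1 : ℝ) else 0 := by
    refine sum_congr rfl fun f _ => sum_congr rfl fun g _ => ?_
    simp [hK]
  have e4 : 8 * (((squareLineGraph H).induce T).edgeSet.ncard : ℝ) =
      ∑ a, ∑ b, ∑ c, ∑ d, K s(a, b) s(c, d) := by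
    rw [e2, e3, ← e]; ring
  rw [e4]
  refine sum_le_sum fun a _ => sum_le_sum fun b _ => sum_le_sum fun c _ => sum_le_sum fun d _ => ?_
  by_cases hk : ∃ (hz : s(a, b) ∈ H.edgeSet) (hw : s(c, d) ∈ H.edgeSet),
      (⟨s(a, b), hz⟩ : H.edgeSet) ∈ T ∧ (⟨s(c, d), hw⟩ : H.edgeSet) ∈ T ∧
        (squareLineGraph H).Adj ⟨s(a, b), hz⟩ ⟨s(c, d), hw⟩
  · rw [show K s(a, b) s(c, d) = 1 from if_pos hk]
    obtain ⟨hz, hw, h1, h2, h3⟩ := hk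
    rw [edgeIndicator_eq_one_iff.2 ⟨hz, h1⟩, edgeIndicator_eq_one_iff.2 ⟨hw, h2⟩,
      min_crossing_eq_one h3 rfl rfl]
    norm_num
  · rw [show K s(a, b) s(c, d) = 0 from if_neg hk]
    refine mul_nonneg (mul_nonneg (edgeIndicator_nonneg _ _) (edgeIndicator_nonneg _ _)) ?_
    refine le_min zero_le_one ?_
    positivity

/-! ### Assembly. -/

theorem mainTheorem8 {V : Type*} [Fintype V] (H : SimpleGraph V) [DecidableRel H.Adj]
    (Δ : ℕ) (hΔ : H.maxDegree = Δ) (η : ℝ) (hη : η ∈ Set.Icc (0 : ℝ) 0.3)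
    (F : Set H.edgeSet) (hF : Maximal (HasMinStrongDegree H ((2 - η) * (Δ : ℝ) ^ 2)) F)
    (e : H.edgeSet) (he : e ∈ F) :
    ((((squareLineGraph H).induce (F ∩ strongNeighborhood H e)).edgeSet.ncard : ℕ) : ℝ) ≤
      (31 / 6 - 128 / (3 * (10 - 3 * η)) + 4 * η - η ^ 2) * (Δ : ℝ) ^ 4 := by
  classical
  obtain ⟨u, v, huv⟩ : ∃ u v, (e : Sym2 V) = s(u, v) := by
    induction h : (e : Sym2 V) with
    | _ u v => exact ⟨u, v, rfl⟩
  have hadj : H.Adj u v := by have := e.2; rwa [huv, SimpleGraph.mem_edgeSet] at this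
  have hΔ0 : 0 < Δ := by
    rw [← hΔ]
    exact ((H.degree_pos_iff_exists_adj u).2 ⟨v, hadj⟩).trans_le (H.degree_le_maxDegree u)
  set T := F ∩ strongNeighborhood H e with hT
  have h8 := eight_mul_ncard_edgeSet_induce_le H T
  have hcore := sum_mul_min_crossing_le (h := fun a b => if H.Adj a b then (1 : ℝ) else 0)
    (r := fun a b => edgeIndicator T s(a, b)) (X := H.neighborFinset u ∪ H.neighborFinset v)
    (Δ := Δ) (η := η) (by exact_mod_cast hΔ0) hη.1 (hη.2.trans (by norm_num))
    (fun a b => by simp only [H.adj_comm]) (fun a b => by simp only [Sym2.eq_swap])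
    (fun a b => edgeIndicator_eq_zero_or_one T _)
    (fun a b => by split_ifs <;> norm_num) (edgeIndicator_le_adj T)
    (sum_adj_le hΔ) ?_ ?_ ?_ ?_
  · linarith
  · intro a b ha hb
    refine (edgeIndicator_eq_zero_or_one T _).resolve_right fun h1 => ?_
    obtain ⟨hz, hm⟩ := edgeIndicator_eq_one_iff.1 h1
    simp only [mem_union, SimpleGraph.mem_neighborFinset, not_or] at ha hb
    have := squareLineGraph_adj_crossing (g := ⟨_, hz⟩) hm.2 huv rfl
    tauto
  · have h1 := Finset.card_union_le (H.neighborFinset u) (H.neighborFinset v)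
    rw [H.card_neighborFinset_eq_degree, H.card_neighborFinset_eq_degree] at h1
    have h2 := H.degree_le_maxDegree u
    have h3 := H.degree_le_maxDegree v
    rw [hΔ] at h2 h3
    exact_mod_cast (show _ ≤ 2 * Δ by omega)
  · intro a b hab
    obtain ⟨hz, hm⟩ := edgeIndicator_eq_one_iff.1 hab
    -- Excess terms are nonnegative, so the excess against F_e is at most that against F, where the
    -- degree condition applies.
    refine le_trans (sum_le_sum fun c _ => sum_le_sum fun d _ => ?_)
      (sum_excess_le hΔ hF.1 hm.1 rfl)
    exact mul_le_mul_of_nonneg_right (edgeIndicator_mono Set.inter_subset_left _)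
      (sub_nonneg.2 (min_le_right _ _))
  · rw [sum_edgeIndicator]
    exact mul_le_mul_of_nonneg_left (hF.1 e he) zero_le_two
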